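/- Let $F_0=0$, $F_1=1$, $F_n=F_{n-1}+F_{n-2}$ for $n\ge 2$ be the Fibonacci numbers, and let $L_0=2$ and $L_n=F_{n-1}+F_{n+1}$ for $n\ge 1$ be the Lucas numbers. Let $\mathbf f=01001010\cdots$ be the infinite Fibonacci word, the fixed point, beginning with $0$, of the morphism $0\mapsto 01$, $1\mapsto 0$. The Rote-Fibonacci word $\mathbf r=0010011011011001\cdots$ is the output, on input $\mathbf f$, of the transducer with two states $q_0$ (initial) and $q_1$ that changes its state at every input letter and, in state $q_0$, outputs $00$ on reading $0$ and $0$ on reading $1$, while in state $q_1$ it outputs $11$ on reading $0$ and $1$ on reading $1$. A factor of $\mathbf r$ is a finite block of consecutive letters of $\mathbf r$. An integer $p\ge 1$ is a period of a finite word $w$ if $w[i]=w[i+p]$ for all $i$ for which both letters exist. Theorem. For $n\ge 1$ let $q(n)$ be the minimum over all periods of all length-$n$ factors of $\mathbf r$. Then $$ q(n)=\begin{cases} 1, & \text{if } 1\le n\le 2;\\ 2, & \text{if } n=3;\\ F_{3j+1}, & \text{if } j\ge 1 \text{ and } L_{3j}\le n<L_{3j+2};\\ L_{3j+1}, & \text{if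 } j\ge 1 \text{ and } L_{3j+2}\le n<L_{3j+2}+F_{3j-2};\\ F_{3j+2}+L_{3j}, & \text{if } j\ge 2 \text{ and } L_{3j+2}+F_{3j-2}\le n<L_{3j+2}+F_{3j-1};\\ 2F_{3j+2}, & \text{if } j\ge 1 \text{ and } L_{3j+2}+F_{3j-1}\le n<L_{3j+3}, \end{cases}$$ and every integer $n\ge 1$ falls under one of these cases for some integer $j$. -/

import Mathlib

namespace RoteFibonacci

/-- The morphism `0 ↦ 01`, `1 ↦ 0`. The letter `0` is `false` and the letter `1` is `true`. -/
def fibMorphism : Bool → List Bool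
  | false => [false, true]
  | true => [false]

/-- The `k`-fold iterate of the Fibonacci morphism on the word `0`; these words are prefixes of
one another and converge to the infinite Fibonacci word. -/
def fibWord : ℕ → List Bool
  | 0 => [false]
  | k + 1 => (fibWord k).flatMap fibMorphism

/-- The two-state transducer: in state `q` it outputs `qq` on reading `0` and `q` on reading `1`,
and in both cases it moves to the other state. The state `q₀` is `false` and `q₁` is `true`. -/
def transduce : Bool → List Bool → List Bool
  | _, [] => []
  | q, false :: w => q :: q :: transduce (!q) w
  | q, true :: w => q :: transduce (!q) w

/-- The letter of index `n` (from `0`) of the Rote-Fibonacci word, the output of the transducer,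
started in state `q₀`, on the infinite Fibonacci word. The output on the prefix `fibWord n` has more
than `n` letters, so the default value of `getD` is never used, see `getElem_transduce_fibWord`. -/
def roteFib (n : ℕ) : Bool :=
  (transduce false (fibWord n)).getD n false

theorem fibWord_prefix_succ (k : ℕ) : fibWord k <+: fibWord (k + 1) := by
  induction k with
  | zero => exact ⟨[true], rfl⟩
  | succ k ih =>
    obtain ⟨t, ht⟩ := ih
    refine ⟨t.flatMap fibMorphism, ?_⟩
    conv_rhs => rw [fibWord, ← ht]
    rw [List.flatMap_append, fibWord]

theorem fibWord_prefix {k l : ℕ} (h : k ≤ l) : fibWord k <+: fibWord l := by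
  induction l, h using Nat.le_induction with
  | base => exact List.prefix_rfl
  | succ l _ ih => exact ih.trans (fibWord_prefix_succ l)

theorem transduce_prefix {u v : List Bool} (h : u <+: v) (q : Bool) :
    transduce q u <+: transduce q v := by
  obtain ⟨t, rfl⟩ := h
  induction u generalizing q with
  | nil => exact List.nil_prefix
  | cons c u ih =>
    cases c <;> simpa [transduce] using ih (!q)

theorem length_le_length_transduce (q : Bool) (w : List Bool) :
    w.length ≤ (transduce q w).length := by
  induction w generalizing q with
  | nil => simp
  | cons c w ih =>
    have := ih (!q)
    cases c <;> simp [transduce] <;> omega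

theorem lt_length_fibWord (k : ℕ) : k < (fibWord k).length := by
  have key : ∀ w : List Bool, w.length + w.count false = (w.flatMap fibMorphism).length := by
    intro w
    induction w with
    | nil => rfl
    | cons c w ih =>
      rw [List.flatMap_cons, List.length_append, ← ih, List.count_cons, List.length_cons]
      cases c <;> simp [fibMorphism] <;> omega
  have hmem : ∀ k, false ∈ fibWord k := fun k =>
    (fibWord_prefix (Nat.zero_le k)).subset (by simp [fibWord])
  induction k with
  | zero => simp [fibWord]
  | succ k ih =>
    have h1 := key (fibWord k)
    have h2 : 0 < (fibWord k).count false := List.count_pos_iff.mpr (hmem k)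
    rw [fibWord]
    omega

/-- The output of the transducer on every word `fibWord k` is a prefix of the Rote-Fibonacci
word. -/
theorem getElem_transduce_fibWord (k n : ℕ) (h : n < (transduce false (fibWord k)).length) :
    (transduce false (fibWord k))[n] = roteFib n := by
  have hn : n < (transduce false (fibWord n)).length :=
    (lt_length_fibWord n).trans_le (length_le_length_transduce _ _)
  rw [roteFib, List.getD_eq_getElem _ _ hn]
  rcases le_total k n with hkn | hkn
  · exact (transduce_prefix (fibWord_prefix hkn) false).getElem h
  · exact ((transduce_prefix (fibWord_prefix hkn) false).getElem hn).symm

/-- The finite word `w` is a factor (a block of consecutive letters) of the infinite word `x`. -/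
def IsFactor (w : List Bool) (x : ℕ → Bool) : Prop :=
  ∃ i, w = List.ofFn fun t : Fin w.length => x (i + t)

/-- The set of all periods of all factors of length `n` of the Rote-Fibonacci word. A period is a
positive integer `p` with `w[i] = w[i + p]` whenever both letters exist, see
`List.hasPeriod_iff_getElem?`. -/
def factorPeriods (n : ℕ) : Set ℕ :=
  {p | ∃ w : List Bool, w.length = n ∧ IsFactor w roteFib ∧ 0 < p ∧ w.HasPeriod p}

/-- The minimum over all periods of all factors of length `n` of the Rote-Fibonacci word; it is
attained by `isLeast_q`. -/
noncomputable def q (n : ℕ) : ℕ :=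
  sInf (factorPeriods n)

theorem isLeast_q (n : ℕ) : IsLeast (factorPeriods n) (q n) := by
  have hne : (factorPeriods n).Nonempty := by
    refine ⟨n + 1, List.ofFn fun t : Fin n => roteFib t, by simp, ⟨0, ?_⟩, by omega, ?_⟩
    · apply List.ext_getElem <;> simp
    · exact List.hasPeriod_of_length_le _ _ (by simp)
  exact ⟨Nat.sInf_mem hne, fun p hp => Nat.sInf_le hp⟩

/-- The Lucas numbers, `L_n = F_{n-1} + F_{n+1}` with `F_{-1} = 1`. -/
def lucas : ℕ → ℕ
  | 0 => 2
  | n + 1 => Nat.fib n + Nat.fib (n + 2)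

end RoteFibonacci

open RoteFibonacci

namespace RoteFibonacci

/-! The word codes a rotation: its letter of index n is decided by the parity of ⌊(n + 2)α⌋, where α
is `alpha` (`roteFib_eq`). A length-n factor has period p exactly when the word agrees with its
p-shift on a block of length n - p (`mem_factorPeriods_iff`).

Such agreement is a question of Diophantine approximation. If F_{k+2} ≤ l < F_{k+3}, a block of
length l works iff |pα - m| < α^k for some even integer m. Sufficiency (`hasRun_of_abs_lt`) uses the
gap left around 0 by the first F_{k+3} - 1 multiples of α; necessity (`exists_abs_lt_of_hasRun`)
uses that F_{k+2} consecutive orbit points meet every interval of length α^k.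

Now write (p, m) = a(F_k, F_{k-1}) + b(F_{k+1}, F_k). Then pα - m = (-α)^k (bα - a), so the
condition becomes |bα - a| < 1 together with a parity condition on (a, b) that depends only on k mod
3. Few pairs give a small p. Each pair below the claimed minimum is excluded because its block would
be long enough to force |bα - a| < α^j for some j with α^j ≤ |bα - a|. In the four infinite
families, the upper end of the range of n is the claimed period plus the Fibonacci number where its
agreement is no longer guaranteed. -/

/-- The inverse of the golden ratio, the slope of the Fibonacci word. -/
noncomputable def alpha : ℝ := (√5 - 1) / 2

/-! ### Powers of `alpha` and its Fibonacci convergents -/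

theorem alpha_sq : alpha ^ 2 = 1 - alpha := by
  have h : √5 ^ 2 = (5 : ℝ) := Real.sq_sqrt (by norm_num)
  unfold alpha
  linarith

theorem lt_alpha : 0.618 < alpha := by
  have h : (2.236 : ℝ) < √5 := Real.lt_sqrt_of_sq_lt (by norm_num)
  unfold alpha
  linarith

theorem alpha_lt : alpha < 0.6181 := by
  have h : √5 < (2.2362 : ℝ) := (Real.sqrt_lt' (by norm_num)).2 (by norm_num)
  unfold alpha
  linarith

theorem alpha_pos : 0 < alpha := by linarith [lt_alpha]

theorem alpha_pow_add_two (k : ℕ) : alpha ^ (k + 2) = alpha ^ k - alpha ^ (k + 1) := by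
  rw [pow_add, alpha_sq]; ring

theorem fib_succ_mul_alpha_sub (k : ℕ) :
    (Nat.fib (k + 1) : ℝ) * alpha - Nat.fib k = alpha * (-alpha) ^ k := by
  induction k using Nat.twoStepInduction with
  | zero => simp
  | one =>
    have := alpha_sq
    simp
    linarith
  | more k h1 h2 =>
    rw [Nat.fib_add_two (n := k + 1), Nat.fib_add_two (n := k)] at *
    push_cast at *
    have e : alpha * (-alpha) ^ (k + 2) = alpha * (-alpha) ^ k + alpha * (-alpha) ^ (k + 1) := by
      rw [pow_add, neg_sq, alpha_sq]; ring
    rw [e, ← h1, ← h2]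
    ring

/-! ### Gaps and return times of the rotation -/

/-- Every integer vector has integer coordinates in the basis of two consecutive convergents of
`alpha`. -/
theorem exists_coords (k : ℕ) (p m : ℤ) : ∃ a b : ℤ,
    p = a * Nat.fib k + b * Nat.fib (k + 1) ∧
    m = a * (Nat.fib (k + 1) - Nat.fib k) + b * Nat.fib k ∧
    (p : ℝ) * alpha - m = (-alpha) ^ k * (b * alpha - a) := by
  induction k with
  | zero => exact ⟨m, p, by simp, by simp, by simp⟩
  | succ k ih =>
    obtain ⟨a, b, h1, h2, h3⟩ := ih
    refine ⟨b - a, a, ?_, ?_, ?_⟩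
    · rw [Nat.fib_add_two (n := k)]; push_cast; rw [h1]; ring
    · rw [Nat.fib_add_two (n := k)]; push_cast; rw [h2]; ring
    · rw [h3, pow_succ]
      push_cast
      linear_combination (-alpha) ^ k * a * alpha_sq

/-- If bα - a lay in (-α², α), then b < 0 would force a < 0 and t < 0; b = 0 would force a = 0; b =
1 leaves no integer a, as the interval has length 1; and b ≥ 2 forces a ≥ 1, so t ≥ F_k + 2F_{k+1} =
F_{k+3}. -/
theorem coords_not_mem_gap {k t : ℕ} {a b : ℤ} (ht : 0 < t) (htk : t < Nat.fib (k + 3))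
    (h : (t : ℤ) = a * Nat.fib k + b * Nat.fib (k + 1)) :
    (b : ℝ) * alpha - a ≤ -alpha ^ 2 ∨ alpha ≤ b * alpha - a := by
  by_contra! hc
  obtain ⟨h1, h2⟩ := hc
  rw [alpha_sq] at h1
  have ha1 := lt_alpha
  have ha2 := alpha_lt
  have hF : (Nat.fib (k + 3) : ℤ) = Nat.fib k + 2 * Nat.fib (k + 1) := by
    rw [Nat.fib_add_two (n := k + 1), Nat.fib_add_two (n := k)]; push_cast; ring
  have hx : (0 : ℤ) ≤ Nat.fib k := by positivity
  have hy : (0 : ℤ) ≤ Nat.fib (k + 1) := by positivity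
  have ht' : (0 : ℤ) < t := by exact_mod_cast ht
  have htk' : (t : ℤ) < Nat.fib (k + 3) := by exact_mod_cast htk
  rcases lt_trichotomy b 0 with hb | rfl | hb
  · have hb' : (b : ℝ) ≤ -1 := by exact_mod_cast (by omega : b ≤ -1)
    have : (a : ℝ) < 0 := by nlinarith
    have ha : a < 0 := by exact_mod_cast this
    nlinarith
  · have h3 : a < 1 := by
      have : (a : ℝ) < 1 := by push_cast at h1; linarith
      exact_mod_cast this
    have h4 : -1 < a := by
      have : (-1 : ℝ) < a := by push_cast at h2; linarith
      exact_mod_cast this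
    obtain rfl : a = 0 := by omega
    simp at h
    omega
  · rcases (by omega : b = 1 ∨ 2 ≤ b) with rfl | hb
    · have h3 : a < 1 := by
        have : (a : ℝ) < 1 := by push_cast at h1; linarith
        exact_mod_cast this
      have h4 : 0 < a := by
        have : (0 : ℝ) < a := by push_cast at h2; linarith
        exact_mod_cast this
      omega
    · have hb' : (2 : ℝ) ≤ b := by exact_mod_cast hb
      have : (0 : ℝ) < a := by nlinarith
      have ha : 0 < a := by exact_mod_cast this
      nlinarith

theorem not_mem_gap_of_even {k t : ℕ} (hk : Even k) (ht : 0 < t) (htk : t < Nat.fib (k + 3))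
    (z : ℤ) : (t : ℝ) * alpha - z ≤ -alpha ^ (k + 2) ∨ alpha ^ (k + 1) ≤ t * alpha - z := by
  obtain ⟨a, b, h1, -, h3⟩ := exists_coords k t z
  rw [hk.neg_pow] at h3
  push_cast at h3
  have hp : 0 ≤ alpha ^ k := (pow_pos alpha_pos k).le
  rw [h3, pow_add _ k 2, pow_add _ k 1, pow_one]
  rcases coords_not_mem_gap ht htk h1 with h | h
  · left; nlinarith
  · right; exact mul_le_mul_of_nonneg_left h hp

theorem not_mem_gap_of_odd {k t : ℕ} (hk : Odd k) (ht : 0 < t) (htk : t < Nat.fib (k + 3))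
    (z : ℤ) : (t : ℝ) * alpha - z ≤ -alpha ^ (k + 1) ∨ alpha ^ (k + 2) ≤ t * alpha - z := by
  obtain ⟨a, b, h1, -, h3⟩ := exists_coords k t z
  rw [hk.neg_pow] at h3
  push_cast at h3
  have hp : 0 ≤ alpha ^ k := (pow_pos alpha_pos k).le
  rw [h3, pow_add _ k 2, pow_add _ k 1, pow_one]
  rcases coords_not_mem_gap ht htk h1 with h | h
  · right; nlinarith
  · left; nlinarith

/-- The first `fib (k + 3) - 1` multiples of `alpha` leave a gap of length `alpha ^ k` around `0`
on the circle. -/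
theorem exists_gap (k : ℕ) : ∃ c d : ℝ, c + d = alpha ^ k ∧ ∀ t : ℕ, 0 < t →
    t < Nat.fib (k + 3) → ∀ z : ℤ, (t : ℝ) * alpha - z ≤ -c ∨ d ≤ t * alpha - z := by
  have h := alpha_pow_add_two k
  rcases Nat.even_or_odd k with hk | hk
  · exact ⟨_, _, by linarith, fun t ht htk z => not_mem_gap_of_even hk ht htk z⟩
  · exact ⟨_, _, by linarith, fun t ht htk z => not_mem_gap_of_odd hk ht htk z⟩

/-- Among `fib (k + 2)` consecutive points of an orbit of the rotation by `alpha`, one lies in the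
interval `[0, alpha ^ k)`. -/
theorem exists_hit (k : ℕ) (x : ℝ) : ∃ s < Nat.fib (k + 2), ∃ z : ℤ,
    0 ≤ x + s * alpha - z ∧ x + s * alpha - z < alpha ^ k := by
  induction k generalizing x with
  | zero =>
    refine ⟨0, by simp, ⌊x⌋, ?_, ?_⟩
    · simp
    · simpa using Int.fract_lt_one x
  | succ k ih =>
    have hp := alpha_pow_add_two k
    have hpos := pow_pos alpha_pos (k + 2)
    have hF := fib_succ_mul_alpha_sub k
    have hfib : Nat.fib (k + 1 + 2) = Nat.fib (k + 1) + Nat.fib (k + 2) := Nat.fib_add_two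
    have hfpos : 0 < Nat.fib (k + 1) := Nat.fib_pos.2 (by omega)
    have hle : alpha ^ (k + 2) ≤ alpha ^ (k + 1) := by
      rw [pow_succ _ (k + 1)]
      exact mul_le_of_le_one_right (pow_pos alpha_pos _).le (by linarith [alpha_lt])
    rcases Nat.even_or_odd k with hk | hk
    · rw [hk.neg_pow, ← pow_succ'] at hF
      -- For even k, F_{k+1} further steps move a point by +α^(k+1). The target is therefore
      -- enlarged to the left, to [-α^(k+2), α^(k+1)), and a point in its negative part is moved.
      -- For odd k the move is backwards and the enlargement is to the right.
      obtain ⟨s, hs, z, h1, h2⟩ := ih (x + alpha ^ (k + 2))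
      by_cases h : 0 ≤ x + s * alpha - z
      · exact ⟨s, by omega, z, h, by linarith⟩
      · refine ⟨s + Nat.fib (k + 1), by omega, z + Nat.fib k, ?_, ?_⟩ <;> push_cast <;> linarith
    · rw [hk.neg_pow, mul_neg, ← pow_succ'] at hF
      obtain ⟨s, hs, z, h1, h2⟩ := ih x
      by_cases h : x + s * alpha - z < alpha ^ (k + 1)
      · exact ⟨s, by omega, z, h1, h⟩
      · refine ⟨s + Nat.fib (k + 1), by omega, z + Nat.fib k, ?_, ?_⟩ <;> push_cast <;> linarith

theorem exists_ge_mul_alpha_mem (s₀ : ℕ) {u v : ℝ} (h : u < v) : ∃ S ≥ s₀, ∃ z : ℤ,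
    u ≤ S * alpha - z ∧ S * alpha - z < v := by
  obtain ⟨k, hk⟩ := exists_pow_lt_of_lt_one (sub_pos.2 h) (by linarith [alpha_lt] : alpha < 1)
  obtain ⟨s, -, z, h1, h2⟩ := exists_hit k (s₀ * alpha - u)
  refine ⟨s₀ + s, by omega, z, ?_, ?_⟩ <;> push_cast <;> linarith

/-! ### The word as a coding of the rotation -/

theorem transduce_append (q : Bool) (u v : List Bool) :
    transduce q (u ++ v) = transduce q u ++ transduce (q ^^ decide (Odd u.length)) v := by
  induction u generalizing q with
  | nil => simp [transduce]
  | cons c u ih =>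
    have h : (!q ^^ decide (Odd u.length)) = (q ^^ decide (Odd (u.length + 1))) := by
      by_cases hu : Odd u.length <;> cases q <;> simp [hu, Nat.odd_add_one]
    cases c <;> simp [transduce, ih, h]

theorem transduce_xor (q c : Bool) (w : List Bool) :
    transduce (q ^^ c) w = (transduce q w).map (· ^^ c) := by
  induction w generalizing q with
  | nil => rfl
  | cons d w ih =>
    have h := ih (!q)
    rw [Bool.not_xor] at h
    cases d <;> simp [transduce, h]

theorem fibWord_add_two (k : ℕ) : fibWord (k + 2) = fibWord (k + 1) ++ fibWord k := by
  induction k with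
  | zero => rfl
  | succ k ih =>
    conv_lhs => rw [fibWord, ih, List.flatMap_append]
    rfl

theorem length_fibWord (k : ℕ) : (fibWord k).length = Nat.fib (k + 2) := by
  induction k using Nat.twoStepInduction with
  | zero => rfl
  | one => rfl
  | more k h1 h2 =>
    rw [fibWord_add_two, List.length_append, h1, h2, Nat.fib_add_two (n := k + 2), add_comm]

theorem length_transduce_fibWord (q : Bool) (k : ℕ) :
    (transduce q (fibWord k)).length = Nat.fib (k + 3) := by
  induction k using Nat.twoStepInduction generalizing q with
  | zero => rfl
  | one => rfl
  | more k h1 h2 =>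
    rw [fibWord_add_two, transduce_append, List.length_append, h1, h2,
      Nat.fib_add_two (n := k + 3), add_comm]

/-- The transducer reads `fibWord (k + 1)`, then `fibWord k`; the parity of the first length F_{k+3}
decides whether the second output is complemented. -/
theorem roteFib_fib_add (k i : ℕ) (hi : i < Nat.fib (k + 3)) :
    roteFib (Nat.fib (k + 4) + i) = (roteFib i ^^ decide (Odd (Nat.fib (k + 3)))) := by
  have h1 : i < (transduce false (fibWord k)).length := by rwa [length_transduce_fibWord]
  have h2 : Nat.fib (k + 4) + i < (transduce false (fibWord (k + 2))).length := by
    rw [length_transduce_fibWord]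
    have : Nat.fib (k + 2 + 3) = Nat.fib (k + 3) + Nat.fib (k + 4) := Nat.fib_add_two
    omega
  rw [← getElem_transduce_fibWord k i h1, ← getElem_transduce_fibWord (k + 2) _ h2]
  simp only [fibWord_add_two, transduce_append, transduce_xor, length_fibWord]
  rw [List.getElem_append_right (by
    rw [length_transduce_fibWord]; exact Nat.le_add_right _ _), List.getElem_map]
  simp [length_transduce_fibWord]

/-- F_{k+4}α differs from F_{k+3} by only α^(k+4), and the gap around 0 keeps sα too far from the
integers for this to change the floor. -/
theorem floor_fib_add_mul_alpha (k s : ℕ) (hs : 0 < s) (hsk : s < Nat.fib (k + 5)) :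
    ⌊((Nat.fib (k + 4) + s : ℕ) : ℝ) * alpha⌋ = Nat.fib (k + 3) + ⌊(s : ℝ) * alpha⌋ := by
  have hF := fib_succ_mul_alpha_sub (k + 3)
  have hpos := pow_pos alpha_pos (k + 4)
  have hlt : alpha ^ (k + 4) < alpha ^ (k + 3) := by
    rw [pow_succ _ (k + 3)]
    exact mul_lt_of_lt_one_right (pow_pos alpha_pos _) (by linarith [alpha_lt])
  have h1 := Int.floor_le ((s : ℝ) * alpha)
  have h2 := Int.lt_floor_add_one ((s : ℝ) * alpha)
  rw [Int.floor_eq_iff]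
  push_cast
  rcases Nat.even_or_odd k with hk | hk
  · rw [(show Odd (k + 3) by grind).neg_pow, mul_neg, ← pow_succ'] at hF
    rcases not_mem_gap_of_even (k := k + 2) (by grind) hs hsk ⌊(s : ℝ) * alpha⌋ with h | h
    · linarith
    · constructor <;> linarith
  · rw [(show Even (k + 3) by grind).neg_pow, ← pow_succ'] at hF
    rcases not_mem_gap_of_odd (k := k + 2) (by grind) hs hsk (⌊(s : ℝ) * alpha⌋ + 1) with h | h
    · push_cast at h
      constructor <;> linarith
    · push_cast at h
      linarith

/-- The Rote-Fibonacci word is a coding of the rotation by `alpha / 2`. -/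
theorem roteFib_eq (n : ℕ) : roteFib n = decide (Even ⌊((n + 2 : ℕ) : ℝ) * alpha⌋) := by
  have key : ∀ k n, n < Nat.fib (k + 3) →
      roteFib n = decide (Even ⌊((n + 2 : ℕ) : ℝ) * alpha⌋) := by
    have ha1 := lt_alpha
    have ha2 := alpha_lt
    have f2 : ⌊(2 : ℝ) * alpha⌋ = 1 := by
      rw [Int.floor_eq_iff]; push_cast; constructor <;> linarith
    have f3 : ⌊(3 : ℝ) * alpha⌋ = 1 := by
      rw [Int.floor_eq_iff]; push_cast; constructor <;> linarith
    have f4 : ⌊(4 : ℝ) * alpha⌋ = 2 := by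
      rw [Int.floor_eq_iff]; push_cast; constructor <;> linarith
    have b0 : roteFib 0 = decide (Even ⌊((0 + 2 : ℕ) : ℝ) * alpha⌋) := by
      push_cast; norm_num [f2]; rfl
    have b1 : roteFib 1 = decide (Even ⌊((1 + 2 : ℕ) : ℝ) * alpha⌋) := by
      push_cast; norm_num [f3]; rfl
    have b2 : roteFib 2 = decide (Even ⌊((2 + 2 : ℕ) : ℝ) * alpha⌋) := by
      push_cast; norm_num [f4]; rfl
    intro k
    induction k using Nat.twoStepInduction with
    | zero =>
      intro n hn
      have : n < 2 := hn
      interval_cases n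
      exacts [b0, b1]
    | one =>
      intro n hn
      have : n < 3 := hn
      interval_cases n
      exacts [b0, b1, b2]
    | more k h1 h2 =>
      intro n hn
      rcases lt_or_ge n (Nat.fib (k + 4)) with h | h
      · exact h2 n h
      obtain ⟨i, rfl⟩ := Nat.exists_eq_add_of_le h
      have e1 : Nat.fib (k + 2 + 3) = Nat.fib (k + 3) + Nat.fib (k + 4) := Nat.fib_add_two
      have e2 : Nat.fib (k + 4) = Nat.fib (k + 2) + Nat.fib (k + 3) := Nat.fib_add_two
      have e3 : 0 < Nat.fib (k + 2) := Nat.fib_pos.2 (by omega)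
      have e4 : Nat.fib 3 ≤ Nat.fib (k + 3) := Nat.fib_mono (by omega)
      have e5 : Nat.fib 3 = 2 := rfl
      have e6 : Nat.fib (k + 5) = Nat.fib (k + 2 + 3) := rfl
      have hi : i < Nat.fib (k + 3) := by omega
      rw [roteFib_fib_add k i hi, h1 i hi, add_assoc,
        floor_fib_add_mul_alpha k (i + 2) (by omega) (by omega)]
      simp only [← Nat.not_even_iff_odd]
      by_cases hc : Even (Nat.fib (k + 3)) <;>
        simp [hc, Int.even_add, -Int.not_even_iff_odd]
  exact key n n (by
    have h1 := lt_length_fibWord n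
    have h2 := length_le_length_transduce false (fibWord n)
    rw [length_transduce_fibWord] at h2
    omega)

/-! ### Agreement with a shift and approximation by even integers -/

/-- The Rote-Fibonacci word agrees with its shift by `p` on a block of length `l`. -/
def HasRun (p l : ℕ) : Prop :=
  ∃ i, ∀ t < l, roteFib (i + t) = roteFib (i + t + p)

theorem HasRun.mono {p l l' : ℕ} (h : HasRun p l) (hl : l' ≤ l) : HasRun p l' := by
  obtain ⟨i, hi⟩ := h
  exact ⟨i, fun t ht => hi t (by omega)⟩

theorem mem_factorPeriods_iff {n p : ℕ} :
    p ∈ factorPeriods n ↔ 0 < p ∧ HasRun p (n - p) := by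
  constructor
  · rintro ⟨w, hw, ⟨i, hi⟩, hp, hper⟩
    refine ⟨hp, i, fun t ht => ?_⟩
    have hget : ∀ s (hs : s < w.length), w[s]? = some (roteFib (i + s)) := by
      intro s hs
      rw [hi, List.getElem?_ofFn]
      simp [hs]
    have := List.hasPeriod_iff_getElem?.1 hper t (by omega)
    rw [hget t (by omega), hget (t + p) (by omega)] at this
    simpa [add_assoc] using this
  · rintro ⟨hp, i, hi⟩
    refine ⟨List.ofFn fun t : Fin n => roteFib (i + t), by simp, ⟨i, ?_⟩, hp, ?_⟩
    · apply List.ext_getElem <;> simp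
    · rw [List.hasPeriod_iff_getElem?]
      intro t ht
      rw [List.length_ofFn] at ht
      have h1 : t < n := by omega
      have h2 : t + p < n := by omega
      simpa [List.getElem?_ofFn, h1, h2, add_assoc] using hi t ht

theorem hasRun_of_abs_lt {p k : ℕ} {m : ℤ} (hm : Even m)
    (h : |(p : ℝ) * alpha - m| < alpha ^ k) : HasRun p (Nat.fib (k + 3) - 1) := by
  obtain ⟨c, d, hcd, hgap⟩ := exists_gap k
  set δ : ℝ := p * alpha - m with hδ
  -- The window has length α^k - |δ| > 0. With Sα in it modulo 1, the gap (-c, d) ensures that no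
  -- integer separates (S + t + 1)α from its translate by δ. The bound S ≥ 1 makes S - 1 a genuine
  -- start.
  obtain ⟨S, hS, Z, hZ1, hZ2⟩ := exists_ge_mul_alpha_mem 1
    (u := -d + max (-δ) 0) (v := c - max δ 0) (by
      rcases le_total 0 δ with h0 | h0
      · rw [abs_of_nonneg h0] at h
        rw [max_eq_left h0, max_eq_right (by linarith)]
        linarith
      · rw [abs_of_nonpos h0] at h
        rw [max_eq_right h0, max_eq_left (by linarith)]
        linarith)
  have l1 := le_max_left (-δ) 0
  have l2 := le_max_right (-δ) 0
  have l3 := le_max_left δ 0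
  have l4 := le_max_right δ 0
  refine ⟨S - 1, fun t ht => ?_⟩
  have e1 : S - 1 + t + 2 = S + (t + 1) := by omega
  have e2 : S - 1 + t + p + 2 = S + (t + 1) + p := by omega
  have hg := hgap (t + 1) (by omega) (by omega)
  rw [roteFib_eq, roteFib_eq, e1, e2]
  set y : ℝ := ((S + (t + 1) : ℕ) : ℝ) * alpha with hy
  have f1 := Int.floor_le y
  have f2 := Int.lt_floor_add_one y
  have hfl : ⌊((S + (t + 1) + p : ℕ) : ℝ) * alpha⌋ = ⌊y⌋ + m := by
    have e : ((S + (t + 1) + p : ℕ) : ℝ) * alpha = y + δ + m := by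
      rw [hδ, hy]; push_cast; ring
    rw [e, Int.floor_add_intCast, add_left_inj, Int.floor_eq_iff]
    have e3 : ((t + 1 : ℕ) : ℝ) * alpha = y - S * alpha := by rw [hy]; push_cast; ring
    rw [e3] at hg
    constructor
    · by_contra! hc
      have := hg (⌊y⌋ - Z)
      push_cast at this
      rcases this with h | h <;> linarith
    · by_contra! hc
      have := hg (⌊y⌋ + 1 - Z)
      push_cast at this
      rcases this with h | h <;> linarith
  rw [hfl]
  simp [Int.even_add, hm]

theorem exists_abs_lt_of_hasRun {p k : ℕ} (h : HasRun p (Nat.fib (k + 2))) :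
    ∃ m : ℤ, Even m ∧ |(p : ℝ) * alpha - m| < alpha ^ k := by
  obtain ⟨i, hi⟩ := h
  have hfp : 0 < Nat.fib (k + 2) := Nat.fib_pos.2 (by omega)
  set D : ℕ → ℤ := fun t => ⌊((i + t + p + 2 : ℕ) : ℝ) * alpha⌋ - ⌊((i + t + 2 : ℕ) : ℝ) * alpha⌋
    with hD
  have hDe : ∀ t < Nat.fib (k + 2), Even (D t) := by
    intro t ht
    have := hi t ht
    rw [roteFib_eq, roteFib_eq, decide_eq_decide] at this
    rw [hD, Int.even_sub]
    exact this.symm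
  have hDb : ∀ t, 0 ≤ Int.fract (((i + t + 2 : ℕ) : ℝ) * alpha) + (p * alpha - D t) ∧
      Int.fract (((i + t + 2 : ℕ) : ℝ) * alpha) + (p * alpha - D t) < 1 := by
    intro t
    have h1 := Int.fract_nonneg (((i + t + p + 2 : ℕ) : ℝ) * alpha)
    have h2 := Int.fract_lt_one (((i + t + p + 2 : ℕ) : ℝ) * alpha)
    have e : Int.fract (((i + t + 2 : ℕ) : ℝ) * alpha) + (p * alpha - D t) =
        Int.fract (((i + t + p + 2 : ℕ) : ℝ) * alpha) := by
      simp only [hD, Int.fract]; push_cast; ring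
    rw [e]
    exact ⟨h1, h2⟩
  -- Two values of D differ by less than 2 and both are even, so they coincide.
  have hDc : ∀ t < Nat.fib (k + 2), D t = D 0 := by
    intro t ht
    have a1 := hDb t
    have a2 := hDb 0
    have b1 := Int.fract_nonneg (((i + t + 2 : ℕ) : ℝ) * alpha)
    have b2 := Int.fract_lt_one (((i + t + 2 : ℕ) : ℝ) * alpha)
    have c1 := Int.fract_nonneg (((i + 0 + 2 : ℕ) : ℝ) * alpha)
    have c2 := Int.fract_lt_one (((i + 0 + 2 : ℕ) : ℝ) * alpha)
    have d1 : D t < D 0 + 2 := by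
      have : (D t : ℝ) < D 0 + 2 := by linarith
      exact_mod_cast this
    have d2 : D 0 < D t + 2 := by
      have : (D 0 : ℝ) < D t + 2 := by linarith
      exact_mod_cast this
    have e1 := hDe t ht
    have e2 := hDe 0 hfp
    rw [Int.even_iff] at e1 e2
    omega
  refine ⟨D 0, hDe 0 hfp, ?_⟩
  rw [abs_lt]
  constructor
  · by_contra! hc
    -- A fractional part in [0, α^k) would be pushed below 0.
    obtain ⟨s, hs, z, h1, h2⟩ := exists_hit k ((i + 2 : ℕ) * alpha)
    have hb := (hDb s).1
    rw [hDc s hs] at hb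
    have e : ((i + s + 2 : ℕ) : ℝ) * alpha = (i + 2 : ℕ) * alpha + s * alpha := by
      push_cast; ring
    have hz : z ≤ ⌊((i + s + 2 : ℕ) : ℝ) * alpha⌋ := Int.le_floor.2 (by linarith)
    have hz' : (z : ℝ) ≤ ⌊((i + s + 2 : ℕ) : ℝ) * alpha⌋ := by exact_mod_cast hz
    rw [Int.fract] at hb
    linarith
  · by_contra! hc
    -- A fractional part in [1 - α^k, 1) would be pushed to 1 or beyond.
    obtain ⟨s, hs, z, h1, h2⟩ := exists_hit k ((i + 2 : ℕ) * alpha + alpha ^ k)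
    have hb := (hDb s).2
    rw [hDc s hs] at hb
    have e : ((i + s + 2 : ℕ) : ℝ) * alpha = (i + 2 : ℕ) * alpha + s * alpha := by
      push_cast; ring
    have hz : ⌊((i + s + 2 : ℕ) : ℝ) * alpha⌋ < z := Int.floor_lt.2 (by linarith)
    have hz' : (⌊((i + s + 2 : ℕ) : ℝ) * alpha⌋ : ℝ) + 1 ≤ z := by exact_mod_cast hz
    rw [Int.fract] at hb
    linarith

/-! ### Shifts in the coordinates (a, b) -/

theorem fib_parity (i : ℕ) : Even (Nat.fib (3 * i)) ∧ Odd (Nat.fib (3 * i + 1)) := by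
  induction i with
  | zero => simp
  | succ i ih =>
    have h2 : Nat.fib (3 * i + 2) = Nat.fib (3 * i) + Nat.fib (3 * i + 1) := Nat.fib_add_two
    have h3 : Nat.fib (3 * (i + 1)) = Nat.fib (3 * i + 1) + Nat.fib (3 * i + 2) := Nat.fib_add_two
    have h4 : Nat.fib (3 * (i + 1) + 1) = Nat.fib (3 * i + 2) + Nat.fib (3 * (i + 1)) :=
      Nat.fib_add_two
    rw [Nat.even_iff, Nat.odd_iff] at *
    omega

theorem hasRun_of_coords (k a b : ℕ)
    (hm : Even ((a : ℤ) * (Nat.fib (k + 1) - Nat.fib k) + b * Nat.fib k))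
    (h : |(b : ℝ) * alpha - a| < 1) :
    HasRun (a * Nat.fib k + b * Nat.fib (k + 1)) (Nat.fib (k + 3) - 1) := by
  refine hasRun_of_abs_lt hm ?_
  have h1 := fib_succ_mul_alpha_sub k
  have h2 := fib_succ_mul_alpha_sub (k + 1)
  rw [Nat.fib_add_two (n := k), pow_succ] at h2
  push_cast at h2
  have e : ((a * Nat.fib k + b * Nat.fib (k + 1) : ℕ) : ℝ) * alpha -
      ((a * (Nat.fib (k + 1) - Nat.fib k) + b * Nat.fib k : ℤ) : ℝ) =
      (-alpha) ^ k * (b * alpha - a) := by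
    push_cast
    linear_combination a * h2 + (b - a) * h1 - (-alpha) ^ k * a * alpha_sq
  rw [e, abs_mul, abs_pow, abs_neg, abs_of_pos alpha_pos]
  exact mul_lt_of_lt_one_right (pow_pos alpha_pos k) h

/-- The decimal inequalities encode |bα - a| < 1 through 0.618 < α < 0.6181, so that `omega` can
list the pairs. The last clause keeps the same (a, b) at every finer level j. -/
theorem coords_of_hasRun {p k l : ℕ} (hp : 0 < p) (h : HasRun p l) (hl : Nat.fib (k + 2) ≤ l) :
    ∃ a b : ℤ, (p : ℤ) = a * Nat.fib k + b * Nat.fib (k + 1) ∧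
      Even (a * (Nat.fib (k + 1) - Nat.fib k) + b * Nat.fib k) ∧ 0 ≤ a ∧ 0 < b ∧
      6180 * b - 10000 < 10000 * a ∧ 10000 * a < 6181 * b + 10000 ∧
      ∀ j, Nat.fib (k + j + 2) ≤ l → |(b : ℝ) * alpha - a| < alpha ^ j := by
  obtain ⟨m, hm, hlt⟩ := exists_abs_lt_of_hasRun (h.mono hl)
  obtain ⟨a, b, h1, h2, h3⟩ := exists_coords k p m
  have ha1 := lt_alpha
  have ha2 := alpha_lt
  have habs : ∀ j, |(p : ℝ) * alpha - m| < alpha ^ (k + j) →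
      |(b : ℝ) * alpha - a| < alpha ^ j := by
    intro j hj
    push_cast at h3
    rw [h3, abs_mul, abs_pow, abs_neg, abs_of_pos alpha_pos, pow_add] at hj
    exact lt_of_mul_lt_mul_left hj (pow_pos alpha_pos k).le
  have h0 := habs 0 hlt
  rw [pow_zero, abs_lt] at h0
  have hx : (0 : ℤ) ≤ Nat.fib k := by positivity
  have hy : (0 : ℤ) ≤ Nat.fib (k + 1) := by positivity
  have hp' : (0 : ℤ) < p := by exact_mod_cast hp
  have hb : 0 < b := by
    by_contra! hb
    have hb' : (b : ℝ) ≤ 0 := by exact_mod_cast hb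
    have : (a : ℝ) < 1 := by nlinarith
    have ha : a < 1 := by exact_mod_cast this
    nlinarith
  have hb' : (1 : ℝ) ≤ b := by exact_mod_cast hb
  have hlo : 6180 * b - 10000 < 10000 * a := by
    have : (6180 : ℝ) * b - 10000 < 10000 * a := by nlinarith
    exact_mod_cast this
  have hhi : 10000 * a < 6181 * b + 10000 := by
    have : (10000 : ℝ) * a < 6181 * b + 10000 := by nlinarith
    exact_mod_cast this
  refine ⟨a, b, h1, h2 ▸ hm, by omega, hb, hlo, hhi, fun j hj => ?_⟩
  obtain ⟨m', hm', hlt'⟩ := exists_abs_lt_of_hasRun (k := k + j) (h.mono hj)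
  have hone : ∀ i, alpha ^ i ≤ 1 := fun i => pow_le_one₀ alpha_pos.le (by linarith)
  -- Only one even integer lies within distance less than 1 of pα.
  have hmm : m' = m := by
    have q1 := abs_lt.1 (hlt.trans_le (hone _))
    have q2 := abs_lt.1 (hlt'.trans_le (hone _))
    have r1 : m' < m + 2 := by
      have : (m' : ℝ) < m + 2 := by linarith
      exact_mod_cast this
    have r2 : m < m' + 2 := by
      have : (m : ℝ) < m' + 2 := by linarith
      exact_mod_cast this
    rw [Int.even_iff] at hm hm'
    omega
  exact habs j (hmm ▸ hlt')

theorem q_eq_of_hasRun {n p : ℕ} (hp : 0 < p) (h : HasRun p (n - p))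
    (hmin : ∀ p', 0 < p' → p' < p → ¬HasRun p' (n - p')) : q n = p := by
  refine (isLeast_q n).unique ⟨mem_factorPeriods_iff.2 ⟨hp, h⟩, fun p' hp' => ?_⟩
  rw [mem_factorPeriods_iff] at hp'
  by_contra! hlt
  exact hmin p' hp'.1 hlt hp'.2

/-! ### Exclusion of smaller periods -/

theorem fib_add_three_eq (k : ℕ) : Nat.fib (k + 3) = Nat.fib k + 2 * Nat.fib (k + 1) := by
  rw [Nat.fib_add_two (n := k + 1), Nat.fib_add_two (n := k)]; ring

theorem fib_add_four_eq (k : ℕ) : Nat.fib (k + 4) = 2 * Nat.fib k + 3 * Nat.fib (k + 1) := by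
  rw [Nat.fib_add_two (n := k + 2), Nat.fib_add_two (n := k), fib_add_three_eq]; ring

theorem fib_add_five_eq (k : ℕ) : Nat.fib (k + 5) = 3 * Nat.fib k + 5 * Nat.fib (k + 1) := by
  rw [Nat.fib_add_two (n := k + 3), fib_add_three_eq, fib_add_four_eq]; ring

/-- Here m ≡ a mod 2. The pairs (0, 1) and (2, 2) fail since α ≥ α² and 2 - 2α ≥ α; (2, 3) already
gives the bound on p. -/
theorem not_hasRun_of_mod_zero {k p l : ℕ} (hx : Even (Nat.fib k)) (hy : Odd (Nat.fib (k + 1)))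
    (hp : 0 < p) (hlt : p < 2 * Nat.fib k + 3 * Nat.fib (k + 1))
    (hl : 3 * Nat.fib k + 4 * Nat.fib (k + 1) ≤ p + l) : ¬HasRun p l := by
  intro hr
  have ha1 := lt_alpha
  have ha2 := alpha_lt
  have g2 : Nat.fib (k + 2) = Nat.fib k + Nat.fib (k + 1) := Nat.fib_add_two
  have g3 := fib_add_three_eq k
  have g4 := fib_add_four_eq k
  obtain ⟨a, b, h1, h2, ha, hb, hlo, hhi, hj⟩ := coords_of_hasRun (k := k) hp hr (by omega)
  have hae : Even a := by
    have hx' : Even (Nat.fib k : ℤ) := by exact_mod_cast hx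
    have hy' : ¬Even (Nat.fib (k + 1) : ℤ) := by
      rw [Int.not_even_iff_odd]; exact_mod_cast hy
    simpa [Int.even_add, Int.even_mul, Int.even_sub, hx', hy'] using h2
  rw [Int.even_iff] at hae
  have hj1 := hj 1
  have hj2 := hj 2
  rw [pow_one, abs_lt] at hj1
  rw [alpha_sq, abs_lt] at hj2
  rw [show k + 1 + 2 = k + 3 from rfl, g3] at hj1
  rw [show k + 2 + 2 = k + 4 from rfl, g4] at hj2
  generalize Nat.fib k = x at *
  generalize Nat.fib (k + 1) = y at *
  have hb4 : b < 4 := by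
    by_contra! hb4
    have : 2 ≤ a := by omega
    have : 2 * (x : ℤ) ≤ a * x := by gcongr
    have : 4 * (y : ℤ) ≤ b * y := by gcongr
    omega
  rcases (by omega : b = 1 ∧ a = 0 ∨ a = 2 ∧ b = 2 ∨ a = 2 ∧ b = 3) with
    ⟨rfl, rfl⟩ | ⟨rfl, rfl⟩ | ⟨rfl, rfl⟩
  · have := hj2 (by omega)
    norm_num at this
    linarith
  · have := hj1 (by omega)
    norm_num at this
    linarith
  · omega

/-- Here m ≡ a + b mod 2. The pair (1, 1) fails only by strictness, as 1 - α = α²; (2, 2) fails at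
level 1. -/
theorem not_hasRun_of_mod_two {k p l : ℕ} (hx : Odd (Nat.fib k)) (hy : Even (Nat.fib (k + 1)))
    (hp : 0 < p) (hlt : p < Nat.fib k + 3 * Nat.fib (k + 1))
    (hl : 3 * Nat.fib k + 4 * Nat.fib (k + 1) ≤ p + l) : ¬HasRun p l := by
  intro hr
  have ha1 := lt_alpha
  have ha2 := alpha_lt
  have g2 : Nat.fib (k + 2) = Nat.fib k + Nat.fib (k + 1) := Nat.fib_add_two
  have g3 := fib_add_three_eq k
  have g4 := fib_add_four_eq k
  obtain ⟨a, b, h1, h2, ha, hb, hlo, hhi, hj⟩ := coords_of_hasRun (k := k) hp hr (by omega)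
  have hae : Even a ↔ Even b := by
    have hy' : Even (Nat.fib (k + 1) : ℤ) := by exact_mod_cast hy
    have hx' : ¬Even (Nat.fib k : ℤ) := by
      rw [Int.not_even_iff_odd]; exact_mod_cast hx
    simpa [Int.even_add, Int.even_mul, Int.even_sub, hx', hy'] using h2
  rw [Int.even_iff, Int.even_iff] at hae
  have hj1 := hj 1
  have hj2 := hj 2
  rw [pow_one, abs_lt] at hj1
  rw [alpha_sq, abs_lt] at hj2
  rw [show k + 1 + 2 = k + 3 from rfl, g3] at hj1
  rw [show k + 2 + 2 = k + 4 from rfl, g4] at hj2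
  generalize Nat.fib k = x at *
  generalize Nat.fib (k + 1) = y at *
  have hb3 : b < 3 := by
    by_contra! hb3
    have : 1 ≤ a := by omega
    have : 1 * (x : ℤ) ≤ a * x := by gcongr
    have : 3 * (y : ℤ) ≤ b * y := by gcongr
    omega
  rcases (by omega : a = 1 ∧ b = 1 ∨ a = 2 ∧ b = 2) with ⟨rfl, rfl⟩ | ⟨rfl, rfl⟩
  · have := hj2 (by omega)
    norm_num at this
  · have := hj1 (by omega)
    norm_num at this
    linarith

/-- Here m ≡ b mod 2. The two alternatives serve the last two families: the first stops before the
pair (3, 6), the second excludes it and stops before (4, 6). The pair (1, 2) fails only by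
strictness, as 2α - 1 = α³. -/
theorem not_hasRun_of_mod_one {k p l : ℕ} (hx : Odd (Nat.fib k)) (hy : Odd (Nat.fib (k + 1)))
    (hp : 0 < p)
    (h : p < 3 * Nat.fib k + 6 * Nat.fib (k + 1) ∧ 5 * Nat.fib k + 7 * Nat.fib (k + 1) ≤ p + l ∨
      p < 4 * Nat.fib k + 6 * Nat.fib (k + 1) ∧ 4 * Nat.fib k + 8 * Nat.fib (k + 1) ≤ p + l) :
    ¬HasRun p l := by
  intro hr
  have ha1 := lt_alpha
  have ha2 := alpha_lt
  have hxy : Nat.fib k ≤ Nat.fib (k + 1) := Nat.fib_le_fib_succ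
  have g2 : Nat.fib (k + 2) = Nat.fib k + Nat.fib (k + 1) := Nat.fib_add_two
  have g3 := fib_add_three_eq k
  have g4 := fib_add_four_eq k
  have g5 := fib_add_five_eq k
  obtain ⟨a, b, h1, h2, ha, hb, hlo, hhi, hj⟩ := coords_of_hasRun (k := k) hp hr (by omega)
  have hbe : Even b := by
    have hx' : ¬Even (Nat.fib k : ℤ) := by
      rw [Int.not_even_iff_odd]; exact_mod_cast hx
    have hy' : ¬Even (Nat.fib (k + 1) : ℤ) := by
      rw [Int.not_even_iff_odd]; exact_mod_cast hy
    simpa [Int.even_add, Int.even_mul, Int.even_sub, hx', hy'] using h2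
  rw [Int.even_iff] at hbe
  have hj1 := hj 1
  have hj2 := hj 2
  have hj3 := hj 3
  rw [pow_one, abs_lt] at hj1
  rw [alpha_sq, abs_lt] at hj2
  rw [alpha_pow_add_two 1, alpha_sq, pow_one, abs_lt] at hj3
  rw [show k + 1 + 2 = k + 3 from rfl, g3] at hj1
  rw [show k + 2 + 2 = k + 4 from rfl, g4] at hj2
  rw [show k + 3 + 2 = k + 5 from rfl, g5] at hj3
  generalize Nat.fib k = x at *
  generalize Nat.fib (k + 1) = y at *
  have hb7 : b < 7 := by
    by_contra! hb7
    have : 4 ≤ a := by omega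
    have : 4 * (x : ℤ) ≤ a * x := by gcongr
    have : 7 * (y : ℤ) ≤ b * y := by gcongr
    omega
  rcases (by omega : a = 1 ∧ b = 2 ∨ a = 2 ∧ b = 2 ∨ a = 2 ∧ b = 4 ∨ a = 3 ∧ b = 4 ∨
      a = 3 ∧ b = 6 ∨ a = 4 ∧ b = 6) with
    ⟨rfl, rfl⟩ | ⟨rfl, rfl⟩ | ⟨rfl, rfl⟩ | ⟨rfl, rfl⟩ | ⟨rfl, rfl⟩ | ⟨rfl, rfl⟩
  · have := hj3 (by omega)
    norm_num at this
    linarith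
  · have := hj1 (by omega)
    norm_num at this
    linarith
  · have := hj2 (by omega)
    norm_num at this
    linarith
  · have := hj2 (by omega)
    norm_num at this
    linarith
  · have := hj1 (by omega)
    norm_num at this
    linarith
  · omega

/-! ### Values of `q` on each range -/

theorem q_of_le_two {n : ℕ} (h : n ≤ 2) : q n = 1 := by
  refine q_eq_of_hasRun one_pos ?_ (fun p' _ _ => by omega)
  have := hasRun_of_coords 0 0 1 (by simp) (by
    rw [abs_lt]; push_cast; constructor <;> linarith [lt_alpha, alpha_lt])
  exact HasRun.mono (by simpa using this) (by simp [Nat.fib]; omega)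

theorem q_three : q 3 = 2 := by
  refine q_eq_of_hasRun two_pos ?_ ?_
  · have := hasRun_of_coords 0 2 2 (by simp) (by
      rw [abs_lt]; push_cast; constructor <;> linarith [lt_alpha, alpha_lt])
    exact HasRun.mono (by simpa using this) (by simp [Nat.fib])
  · intro p' hp hlt hr
    -- An even m with |α - m| < α would satisfy 0 < m < 2.
    obtain rfl : p' = 1 := by omega
    obtain ⟨m, hm, h⟩ := exists_abs_lt_of_hasRun (k := 1) (hr.mono (by simp [Nat.fib]))
    rw [pow_one, abs_lt] at h
    push_cast at h
    have ha := alpha_lt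
    have r1 : 0 < m := by
      have : (0 : ℝ) < m := by linarith
      exact_mod_cast this
    have r2 : m < 2 := by
      have : (m : ℝ) < 2 := by linarith
      exact_mod_cast this
    rw [Int.even_iff] at hm
    omega

theorem fib_offsets (i : ℕ) :
    Nat.fib (3 * i + 2) = Nat.fib (3 * i) + Nat.fib (3 * i + 1) ∧
    Nat.fib (3 * i + 3) = Nat.fib (3 * i) + 2 * Nat.fib (3 * i + 1) ∧
    Nat.fib (3 * i + 4) = 2 * Nat.fib (3 * i) + 3 * Nat.fib (3 * i + 1) ∧
    Nat.fib (3 * i + 5) = 3 * Nat.fib (3 * i) + 5 * Nat.fib (3 * i + 1) ∧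
    Nat.fib (3 * i + 6) = 5 * Nat.fib (3 * i) + 8 * Nat.fib (3 * i + 1) ∧
    Nat.fib (3 * i + 7) = 8 * Nat.fib (3 * i) + 13 * Nat.fib (3 * i + 1) := by
  have h2 : Nat.fib (3 * i + 2) = Nat.fib (3 * i) + Nat.fib (3 * i + 1) := Nat.fib_add_two
  have h3 := fib_add_three_eq (3 * i)
  have h4 := fib_add_four_eq (3 * i)
  have h5 := fib_add_five_eq (3 * i)
  have h6 : Nat.fib (3 * i + 6) = Nat.fib (3 * i + 4) + Nat.fib (3 * i + 5) := Nat.fib_add_two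
  have h7 : Nat.fib (3 * i + 7) = Nat.fib (3 * i + 5) + Nat.fib (3 * i + 6) := Nat.fib_add_two
  omega

theorem lucas_offsets (i : ℕ) :
    lucas (3 * i + 3) = 3 * Nat.fib (3 * i) + 4 * Nat.fib (3 * i + 1) ∧
    lucas (3 * i + 4) = 4 * Nat.fib (3 * i) + 7 * Nat.fib (3 * i + 1) ∧
    lucas (3 * i + 5) = 7 * Nat.fib (3 * i) + 11 * Nat.fib (3 * i + 1) ∧
    lucas (3 * i + 6) = 11 * Nat.fib (3 * i) + 18 * Nat.fib (3 * i + 1) := by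
  obtain ⟨h2, h3, h4, h5, h6, h7⟩ := fib_offsets i
  have l3 : lucas (3 * i + 3) = Nat.fib (3 * i + 2) + Nat.fib (3 * i + 4) := rfl
  have l4 : lucas (3 * i + 4) = Nat.fib (3 * i + 3) + Nat.fib (3 * i + 5) := rfl
  have l5 : lucas (3 * i + 5) = Nat.fib (3 * i + 4) + Nat.fib (3 * i + 6) := rfl
  have l6 : lucas (3 * i + 6) = Nat.fib (3 * i + 5) + Nat.fib (3 * i + 7) := rfl
  omega

theorem q_of_lucas_le {i n : ℕ} (h1 : lucas (3 * i + 3) ≤ n) (h2 : n < lucas (3 * i + 5)) :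
    q n = Nat.fib (3 * i + 4) := by
  obtain ⟨hx, hy⟩ := fib_parity i
  obtain ⟨f2, f3, f4, f5, f6, f7⟩ := fib_offsets i
  obtain ⟨l3, l4, l5, l6⟩ := lucas_offsets i
  refine q_eq_of_hasRun (Nat.fib_pos.2 (by omega)) ?_ fun p' hp hlt =>
    not_hasRun_of_mod_zero hx hy hp (by omega) (by omega)
  have hr := hasRun_of_coords (3 * i + 3) 0 1 (by
    have : Even (Nat.fib (3 * i + 3)) := (fib_parity (i + 1)).1
    simpa using this) (by
    rw [abs_lt]; push_cast; constructor <;> linarith [lt_alpha, alpha_lt])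
  simp only [zero_mul, one_mul, zero_add] at hr
  exact hr.mono (show _ ≤ Nat.fib (3 * i + 6) - 1 by omega)

theorem q_of_lucas_add_two_le {i n : ℕ} (h1 : lucas (3 * i + 5) ≤ n)
    (h2 : n < lucas (3 * i + 5) + Nat.fib (3 * i + 1)) : q n = lucas (3 * i + 4) := by
  obtain ⟨hx, hy⟩ := fib_parity i
  obtain ⟨hx', hy'⟩ := fib_parity (i + 1)
  obtain ⟨f2, f3, f4, f5, f6, f7⟩ := fib_offsets i
  obtain ⟨l3, l4, l5, l6⟩ := lucas_offsets i
  have hx2 : Odd (Nat.fib (3 * i + 2)) := by rw [f2]; exact hx.add_odd hy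
  have hx3 : Even (Nat.fib (3 * i + 2 + 1)) := hx'
  have e : Nat.fib (3 * i + 2 + 1) = Nat.fib (3 * i + 3) := rfl
  refine q_eq_of_hasRun (by omega) ?_ fun p' hp hlt =>
    not_hasRun_of_mod_two hx2 hx3 hp (by omega) (by omega)
  -- The first pair that `not_hasRun_of_mod_two` leaves open; |3α - 1| < 1.
  have hr := hasRun_of_coords (3 * i + 2) 1 3 (by
    rw [Nat.even_iff] at hx3
    push_cast
    rw [Int.even_iff]
    omega) (by
    rw [abs_lt]; push_cast; constructor <;> linarith [lt_alpha, alpha_lt])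
  rw [show 1 * Nat.fib (3 * i + 2) + 3 * Nat.fib (3 * i + 2 + 1) = lucas (3 * i + 4) by omega] at hr
  exact hr.mono (show _ ≤ Nat.fib (3 * i + 5) - 1 by omega)

theorem q_of_lucas_add_fib_le {i n : ℕ} (h1 : lucas (3 * i + 5) + Nat.fib (3 * i + 1) ≤ n)
    (h2 : n < lucas (3 * i + 5) + Nat.fib (3 * i + 2)) :
    q n = Nat.fib (3 * i + 5) + lucas (3 * i + 3) := by
  obtain ⟨hx, hy⟩ := fib_parity i
  obtain ⟨f2, f3, f4, f5, f6, f7⟩ := fib_offsets i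
  obtain ⟨l3, l4, l5, l6⟩ := lucas_offsets i
  have hx2 : Odd (Nat.fib (3 * i + 1 + 1)) := by
    rw [show 3 * i + 1 + 1 = 3 * i + 2 from rfl, f2]; exact hx.add_odd hy
  have e : Nat.fib (3 * i + 1 + 1) = Nat.fib (3 * i + 2) := rfl
  refine q_eq_of_hasRun (by omega) ?_ fun p' hp hlt =>
    not_hasRun_of_mod_one hy hx2 hp (by omega)
  have hr := hasRun_of_coords (3 * i + 1) 3 6 (by
    rw [Nat.odd_iff] at hx2 hy
    push_cast
    rw [Int.even_iff]
    omega) (by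
    rw [abs_lt]; push_cast; constructor <;> linarith [lt_alpha, alpha_lt])
  rw [show 3 * Nat.fib (3 * i + 1) + 6 * Nat.fib (3 * i + 1 + 1) =
    Nat.fib (3 * i + 5) + lucas (3 * i + 3) by omega] at hr
  exact hr.mono (show _ ≤ Nat.fib (3 * i + 4) - 1 by omega)

theorem q_of_lt_lucas_add_three {i n : ℕ} (h1 : lucas (3 * i + 5) + Nat.fib (3 * i + 2) ≤ n)
    (h2 : n < lucas (3 * i + 6)) : q n = 2 * Nat.fib (3 * i + 5) := by
  obtain ⟨hx, hy⟩ := fib_parity i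
  obtain ⟨f2, f3, f4, f5, f6, f7⟩ := fib_offsets i
  obtain ⟨l3, l4, l5, l6⟩ := lucas_offsets i
  have hpos : 0 < Nat.fib (3 * i + 1) := hy.pos
  have hx2 : Odd (Nat.fib (3 * i + 1 + 1)) := by
    rw [show 3 * i + 1 + 1 = 3 * i + 2 from rfl, f2]; exact hx.add_odd hy
  have e : Nat.fib (3 * i + 1 + 1) = Nat.fib (3 * i + 2) := rfl
  refine q_eq_of_hasRun (by omega) ?_ fun p' hp hlt =>
    not_hasRun_of_mod_one hy hx2 hp (by omega)
  have e' : Nat.fib (3 * i + 3 + 1) = Nat.fib (3 * i + 4) := rfl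
  -- This is the pair (4, 6) of level 3i + 1, rewritten two levels up, where the guaranteed block is
  -- longer.
  have hr := hasRun_of_coords (3 * i + 3) 2 2 (by
    push_cast
    rw [Int.even_iff]
    omega) (by
    rw [abs_lt]; push_cast; constructor <;> linarith [lt_alpha, alpha_lt])
  rw [show 2 * Nat.fib (3 * i + 3) + 2 * Nat.fib (3 * i + 3 + 1) = 2 * Nat.fib (3 * i + 5) by
    omega] at hr
  exact hr.mono (show _ ≤ Nat.fib (3 * i + 6) - 1 by omega)

theorem exists_lucas_interval {n : ℕ} (hn : 4 ≤ n) :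
    ∃ i, lucas (3 * i + 3) ≤ n ∧ n < lucas (3 * i + 6) := by
  induction n, hn using Nat.le_induction with
  | base => exact ⟨0, by decide, by decide⟩
  | succ n _ ih =>
    obtain ⟨i, h1, h2⟩ := ih
    rcases (by omega : n + 1 < lucas (3 * i + 6) ∨ n + 1 = lucas (3 * i + 6)) with h | h
    · exact ⟨i, by omega, h⟩
    · refine ⟨i + 1, h.ge, ?_⟩
      obtain ⟨l3, -, -, l6⟩ := lucas_offsets (i + 1)
      have := (fib_parity (i + 1)).2.pos
      have e : lucas (3 * (i + 1) + 3) = lucas (3 * i + 6) := rfl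
      omega

end RoteFibonacci

open RoteFibonacci

theorem mainTheorem4 :
    (∀ n : ℕ, 1 ≤ n → n ≤ 2 → q n = 1) ∧
    (∀ n : ℕ, n = 3 → q n = 2) ∧
    (∀ j n : ℕ, 1 ≤ j → lucas (3 * j) ≤ n → n < lucas (3 * j + 2) →
      q n = Nat.fib (3 * j + 1)) ∧
    (∀ j n : ℕ, 1 ≤ j → lucas (3 * j + 2) ≤ n → n < lucas (3 * j + 2) + Nat.fib (3 * j - 2) →
      q n = lucas (3 * j + 1)) ∧
    (∀ j n : ℕ, 2 ≤ j → lucas (3 * j + 2) + Nat.fib (3 * j - 2) ≤ n →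
      n < lucas (3 * j + 2) + Nat.fib (3 * j - 1) →
      q n = Nat.fib (3 * j + 2) + lucas (3 * j)) ∧
    (∀ j n : ℕ, 1 ≤ j → lucas (3 * j + 2) + Nat.fib (3 * j - 1) ≤ n → n < lucas (3 * j + 3) →
      q n = 2 * Nat.fib (3 * j + 2)) ∧
    -- the six cases cover all lengths `n ≥ 1`
    (∀ n : ℕ, 1 ≤ n → n ≤ 2 ∨ n = 3 ∨ ∃ j : ℕ, 1 ≤ j ∧
      ((lucas (3 * j) ≤ n ∧ n < lucas (3 * j + 2)) ∨
       (lucas (3 * j + 2) ≤ n ∧ n < lucas (3 * j + 2) + Nat.fib (3 * j - 2)) ∨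
       (2 ≤ j ∧ lucas (3 * j + 2) + Nat.fib (3 * j - 2) ≤ n ∧
          n < lucas (3 * j + 2) + Nat.fib (3 * j - 1)) ∨
       (lucas (3 * j + 2) + Nat.fib (3 * j - 1) ≤ n ∧ n < lucas (3 * j + 3)))) := by
  refine ⟨fun n _ h => q_of_le_two h, fun n hn => hn ▸ q_three, ?_, ?_, ?_, ?_, ?_⟩
  · intro j n hj h1 h2
    obtain ⟨i, rfl⟩ := Nat.exists_eq_add_of_le' hj
    exact q_of_lucas_le h1 h2
  · intro j n hj h1 h2
    obtain ⟨i, rfl⟩ := Nat.exists_eq_add_of_le' hj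
    exact q_of_lucas_add_two_le h1 h2
  · intro j n hj h1 h2
    obtain ⟨i, rfl⟩ := Nat.exists_eq_add_of_le' (Nat.one_le_of_lt hj)
    exact q_of_lucas_add_fib_le h1 h2
  · intro j n hj h1 h2
    obtain ⟨i, rfl⟩ := Nat.exists_eq_add_of_le' hj
    exact q_of_lt_lucas_add_three h1 h2
  · intro n hn
    rcases (by omega : n ≤ 2 ∨ n = 3 ∨ 4 ≤ n) with h | h | h
    · exact Or.inl h
    · exact Or.inr (Or.inl h)
    refine Or.inr (Or.inr ?_)
    obtain ⟨i, h1, h2⟩ := exists_lucas_interval h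
    refine ⟨i + 1, by omega, ?_⟩
    have e2 : 3 * (i + 1) - 2 = 3 * i + 1 := by omega
    have e1 : 3 * (i + 1) - 1 = 3 * i + 2 := by omega
    have e0 : 3 * (i + 1) = 3 * i + 3 := by ring
    -- For j = 1 the third family is empty because F_1 = F_2, so the restriction j ≥ 2 loses no n.
    have hi : i = 0 → Nat.fib (3 * i + 1) = Nat.fib (3 * i + 2) := by rintro rfl; rfl
    rw [e2, e1, e0]
    rw [show 3 * i + 3 + 3 = 3 * i + 6 from rfl]
    omega
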